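/- For a number field $\mathbb K$ of degree $n$ and signature $(s,t)$ (that is, with $s$ real embeddings and $t$ conjugate pairs of non-real complex embeddings, so $n=s+2t$), let $\psi:\mathbb K\to\mathbb R^s\times\mathbb C^t\cong\mathbb R^n$ be the embedding given by the $s$ real embeddings and one embedding from each conjugate pair of complex embeddings. Let $\Lambda_{\mathbb K}=\psi(\mathbb Z_{\mathbb K})$, where $\mathbb Z_{\mathbb K}$ is the ring of integers, let $d(\Lambda_{\mathbb K})$ be the Euclidean length of a shortest non-zero vector of $\Lambda_{\mathbb K}$, where $\|(x_1,\dots,x_s,z_1,\dots,z_t)\|^2=\sum_i x_i^2+\sum_j|z_j|^2$, and put $m(\mathbb K)=d(\Lambda_{\mathbb K})^2/(s+t)$. **Theorem.** There is an absolute constant $C$ such that for every even integer $s\ge 2$ and every integer $k\ge 1$ there is a number field $\mathbb K$ of degree $n=(2k+1)s$ and signature $(s,(n-s)/2)$ with $$d(\Lambda_{\mathbb K})^2\le \frac n2+\frac{s\log 2}{2}+C\,s^{5/4}n^{-1/4} \qquad\text{and, consequently,}\qquad m(\mathbb K)\le 1-\frac{1-\log 2}{2(k+1)}+C\,k^{-5/4}.$$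 This nearly matches the general lower bound: every number field $\mathbb L$ of degree $n$ and signature $(s,t)$ satisfies $$m(\mathbb L)\ge \frac{2^{s/n}}{1+s/n},$$ while the field $\mathbb K$ above satisfies $m(\mathbb K)\le \dfrac{2^{s/n}}{1+s/n}+C\,k^{-5/4}$. -/

import Mathlib

/-- `K` has signature `(s, t)`: exactly `s` real embeddings and exactly `t` conjugate pairs of
non-real complex embeddings. -/
def HasSignature (K : Type*) [Field K] [NumberField K] (s t : ℕ) : Prop :=
  NumberField.InfinitePlace.nrRealPlaces K = s ∧ NumberField.InfinitePlace.nrComplexPlaces K = t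

/-- The space `ℝ^s × ℂ^t`, with `(s, t)` the signature of `K`, carrying the Euclidean norm
`(∑ x_i ^ 2 + ∑ (y_j ^ 2 + z_j ^ 2)) ^ (1 / 2)`. -/
abbrev SignatureSpace (K : Type*) [Field K] : Type _ :=
  WithLp 2 (EuclideanSpace ℝ {w : NumberField.InfinitePlace K // w.IsReal} ×
    EuclideanSpace ℂ {w : NumberField.InfinitePlace K // w.IsComplex})

/-- The embedding `ψ : K → ℝ^s × ℂ^t` given by the real embeddings of `K` and by one embedding out
of each conjugate pair of non-real complex embeddings. -/
noncomputable def vectorEmbedding (K : Type*) [Field K] : K →+ SignatureSpace K where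
  toFun a := WithLp.toLp 2
    (WithLp.toLp 2 fun w => NumberField.InfinitePlace.embedding_of_isReal w.2 a,
      WithLp.toLp 2 fun w => w.1.embedding a)
  map_zero' := by
    simp only [map_zero]
    rfl
  map_add' a b := by
    simp only [map_add]
    rfl

/-- The lattice `Λ_K = ψ(ℤ_K)`, where `ℤ_K` is the ring of integers of `K`. -/
noncomputable def numberFieldLattice (K : Type*) [Field K] [NumberField K] :
    AddSubgroup (SignatureSpace K) :=
  ((vectorEmbedding K).comp
    (algebraMap (NumberField.RingOfIntegers K) K : NumberField.RingOfIntegers K →+ K)).range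

open scoped Classical in
/-- The minimum distance `d(Λ_K)` of the lattice `Λ_K`, i.e. the length of its shortest non-zero
vector. The infimum is attained, see `latticeMinDist_isLeast`. -/
noncomputable def latticeMinDist (K : Type*) [Field K] [NumberField K] : ℝ :=
  sInf {r : ℝ | ∃ x ∈ numberFieldLattice K, x ≠ 0 ∧ ‖x‖ = r}

/-- The normalised square of the minimum distance, `m(K) = d(Λ_K)^2 / (s + t)`, where `(s, t)` is
the signature of `K`. -/
noncomputable def normalisedMinDistSq (K : Type*) [Field K] [NumberField K] : ℝ :=
  latticeMinDist K ^ 2 /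
    ((NumberField.InfinitePlace.nrRealPlaces K : ℝ) + NumberField.InfinitePlace.nrComplexPlaces K)

open scoped Classical in
/-- The norm of `ψ(a)` in terms of the normalised archimedean absolute values. -/
theorem norm_vectorEmbedding_sq (K : Type*) [Field K] [NumberField K] (a : K) :
    ‖vectorEmbedding K a‖ ^ 2 = ∑ w : NumberField.InfinitePlace K, w a ^ 2 := by
  rw [WithLp.prod_norm_sq_eq_of_L2, EuclideanSpace.norm_sq_eq, EuclideanSpace.norm_sq_eq,
    NumberField.InfinitePlace.sum_eq_sum_add_sum]
  congr 1
  · refine Finset.sum_congr rfl fun w _ => ?_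
    rw [← NumberField.InfinitePlace.norm_embedding_of_isReal w.2]
    rfl
  · refine Finset.sum_congr rfl fun w _ => ?_
    rw [← NumberField.InfinitePlace.norm_embedding_eq]
    rfl

open scoped Classical in
/-- The infimum defining `latticeMinDist` is a minimum. -/
theorem latticeMinDist_isLeast (K : Type*) [Field K] [NumberField K] :
    IsLeast {r : ℝ | ∃ x ∈ numberFieldLattice K, x ≠ 0 ∧ ‖x‖ = r} (latticeMinDist K) := by
  have hinj : ∀ a : K, vectorEmbedding K a = 0 → a = 0 := by
    intro a ha
    have h := norm_vectorEmbedding_sq K a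
    rw [ha, norm_zero, eq_comm, zero_pow two_ne_zero,
      Finset.sum_eq_zero_iff_of_nonneg (fun w _ => sq_nonneg _)] at h
    obtain ⟨w⟩ := (inferInstance : Nonempty (NumberField.InfinitePlace K))
    exact (map_eq_zero w).mp (pow_eq_zero_iff two_ne_zero |>.mp (h w (Finset.mem_univ w)))
  have hfin : {x : SignatureSpace K | x ∈ numberFieldLattice K ∧
      ‖x‖ ≤ ‖vectorEmbedding K 1‖}.Finite := by
    refine ((NumberField.Embeddings.finite_of_norm_le K ℂ ‖vectorEmbedding K 1‖).image
      (vectorEmbedding K)).subset ?_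
    rintro x ⟨⟨a, rfl⟩, hx⟩
    refine ⟨a, ⟨NumberField.RingOfIntegers.isIntegral_coe a, fun φ => ?_⟩, rfl⟩
    refine le_trans ?_ hx
    refine (sq_le_sq₀ (norm_nonneg _) (norm_nonneg _)).mp ?_
    have h := norm_vectorEmbedding_sq K (a : K)
    refine le_trans ?_ h.ge
    exact Finset.single_le_sum (f := fun w : NumberField.InfinitePlace K => w (a : K) ^ 2)
      (fun w _ => sq_nonneg _) (Finset.mem_univ (NumberField.InfinitePlace.mk φ))
  have h1 : vectorEmbedding K 1 ∈ numberFieldLattice K := ⟨1, by simp⟩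
  have h1' : vectorEmbedding K 1 ≠ 0 := fun h => one_ne_zero (hinj 1 h)
  obtain ⟨y, ⟨⟨hy1, hy2⟩, hy3⟩, hmin⟩ := Set.exists_min_image _ (fun x => ‖x‖)
    (hfin.subset (Set.sdiff_subset (t := {0}))) ⟨_, ⟨h1, le_rfl⟩, h1'⟩
  have hleast : IsLeast {r : ℝ | ∃ x ∈ numberFieldLattice K, x ≠ 0 ∧ ‖x‖ = r} ‖y‖ := by
    refine ⟨⟨y, hy1, hy3, rfl⟩, ?_⟩
    rintro r ⟨x, hx, hx0, rfl⟩
    by_cases h : ‖x‖ ≤ ‖vectorEmbedding K 1‖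
    · exact hmin x ⟨⟨hx, h⟩, hx0⟩
    · exact hy2.trans (not_le.mp h).le
  have h : latticeMinDist K = ‖y‖ := hleast.csInf_eq
  rw [h]
  exact hleast

/-! The upper bound comes from one explicit unit. With N = 2k + 1, let `a` be a root of X^(2N) +
2X^2 - 1. Its only conjugates in the closed unit disc are ±x with x^2 = y just below 1/2, and these
are also the only real ones. All other conjugates lie barely outside the unit circle, so there |a|^2
= 1 + log |a|^2 + O(1/N^2). Since `a` is a unit, the logarithms of all its absolute values, weighted
by multiplicity, sum to zero. The logarithms at the complex places therefore total about (log 2)/2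
per real place, and the squared length is about s/2 + t + (s log 2)/2 = n/2 + (s log 2)/2.

The trinomial is irreducible (`irreducible_evenTrinomial`), so the root generates a field of degree
2N with two real embeddings. An extension of degree s/2 in which real embeddings stay real
(`exists_extension_isReal`) gives the required signature, and `a` is reused there. The resulting
error O(s/N) is smaller than the one required.

The lower bound is the arithmetic-geometric mean inequality together with the fact that a nonzero
algebraic integer has norm at least 1 in absolute value. -/

/-! ### The trinomial: small roots and irreducibility -/

open Polynomial in
/-- The polynomial `X ^ (2 * N) + 2 * X ^ 2 - 1`. -/
noncomputable def evenTrinomial (N : ℕ) : ℤ[X] := X ^ (2 * N) + (2 * X ^ 2 - 1)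

theorem exists_small_root {N : ℕ} (hN : N ≠ 0) :
    ∃ y : ℝ, 0 < y ∧ y < 1 / 2 ∧ y ^ N + 2 * y = 1 := by
  have hc : ContinuousOn (fun y : ℝ => y ^ N + 2 * y) (Set.Icc 0 (1 / 2)) := by fun_prop
  have hp : (0 : ℝ) < (1 / 2) ^ N := by positivity
  obtain ⟨y, hy, h⟩ := intermediate_value_Ioo (by norm_num) hc
    (show (1 : ℝ) ∈ Set.Ioo _ _ from ⟨by simp [hN], by linarith⟩)
  exact ⟨y, hy.1, hy.2, h⟩

/-- Subtracting the two equations gives (S + 2)(z - y) = 0 with S = ∑ z^i y^(N-1-i). Here |S| ≤ ∑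
y^i < 1/(1 - y) < 2, so the first factor cannot vanish. -/
theorem eq_small_root {N : ℕ} {y : ℝ} (hy0 : 0 < y) (hy1 : y < 1 / 2)
    (hy : y ^ N + 2 * y = 1) {z : ℂ} (hz1 : ‖z‖ ≤ 1) (hz : z ^ N + 2 * z = 1) : z = y := by
  have hy' : (y : ℂ) ^ N + 2 * y = 1 := by exact_mod_cast hy
  set S : ℂ := ∑ i ∈ Finset.range N, z ^ i * (y : ℂ) ^ (N - 1 - i) with hS
  have h1 : (S + 2) * (z - y) = 0 := by
    rw [add_mul, hS, Commute.geom_sum₂_mul (Commute.all _ _)]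
    linear_combination hz - hy'
  rcases mul_eq_zero.mp h1 with h | h
  · exfalso
    have h2 : ‖S‖ = 2 := by
      rw [eq_neg_of_add_eq_zero_left h]
      simp
    have h3 : ‖S‖ ≤ ∑ i ∈ Finset.range N, y ^ i := by
      rw [← Finset.sum_range_reflect]
      refine norm_sum_le_of_le _ fun i _ => ?_
      rw [norm_mul, norm_pow, norm_pow, Complex.norm_of_nonneg hy0.le]
      exact mul_le_of_le_one_left (by positivity) (pow_le_one₀ (norm_nonneg _) hz1)
    have h4 := geom_sum_mul y N
    have h5 : 0 < y ^ N := by positivity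
    nlinarith
  · exact sub_eq_zero.mp h

open Polynomial in
theorem aeval_evenTrinomial {R : Type*} [CommRing R] (N : ℕ) (z : R) :
    aeval z (evenTrinomial N) = (z ^ 2) ^ N + 2 * z ^ 2 - 1 := by
  simp [evenTrinomial, pow_mul, add_sub_assoc, map_ofNat]

open Polynomial in
theorem degree_two_mul_X_sq_sub_one_le : (2 * X ^ 2 - 1 : ℤ[X]).degree ≤ 2 := by
  compute_degree

open Polynomial in
theorem evenTrinomial_monic {N : ℕ} (hN : 2 ≤ N) : (evenTrinomial N).Monic :=
  monic_X_pow_add (degree_two_mul_X_sq_sub_one_le.trans_lt (by norm_cast; omega))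

open Polynomial in
theorem natDegree_evenTrinomial {N : ℕ} (hN : 2 ≤ N) : (evenTrinomial N).natDegree = 2 * N := by
  refine natDegree_eq_of_degree_eq_some ?_
  rw [evenTrinomial, degree_add_eq_left_of_degree_lt, degree_X_pow]
  rw [degree_X_pow]
  exact degree_two_mul_X_sq_sub_one_le.trans_lt (by norm_cast; omega)

/-- The roots of `evenTrinomial N` in the closed unit disc. -/
theorem root_evenTrinomial_of_norm_le_one {N : ℕ} {x : ℝ} (hx0 : 0 < x)
    (hx1 : x ^ 2 < 1 / 2) (hx : (x ^ 2) ^ N + 2 * x ^ 2 = 1) {z : ℂ} (hz1 : ‖z‖ ≤ 1)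
    (hz : Polynomial.aeval z (evenTrinomial N) = 0) : z = x ∨ z = -x := by
  rw [aeval_evenTrinomial] at hz
  have h := eq_small_root (by positivity) hx1 hx (z := z ^ 2)
    (by rw [norm_pow]; exact pow_le_one₀ (norm_nonneg _) hz1) (by linear_combination hz)
  push_cast at h
  exact sq_eq_sq_iff_eq_or_eq_neg.mp h

open Polynomial in
/-- A monic integer polynomial with constant term `±1` has a complex root in the closed unit
disc. -/
theorem exists_root_norm_le_one {p : ℤ[X]} (hp : p.Monic) (hdeg : p ≠ 1)
    (h0 : IsUnit (p.coeff 0)) : ∃ z : ℂ, ‖z‖ ≤ 1 ∧ aeval z p = 0 := by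
  by_contra! hcon
  set P : ℂ[X] := p.map (algebraMap ℤ ℂ) with hP
  have hPm : P.Monic := hp.map _
  have hs : P.Splits := IsAlgClosed.splits P
  have hroots : ∀ z ∈ P.roots, 1 < ‖z‖ := by
    intro z hz
    by_contra! h
    refine hcon z h ?_
    have := isRoot_of_mem_roots hz
    rwa [IsRoot, hP, eval_map_algebraMap] at this
  have hcard : P.roots ≠ 0 := by
    intro h
    have h1 := hs.natDegree_eq_card_roots
    rw [h, Multiset.card_zero, hP, hp.natDegree_map] at h1
    exact hdeg (hp.natDegree_eq_zero.mp h1)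
  -- The constant term is, up to sign, the product of the roots, so they cannot all lie outside the
  -- disc.
  have hprod : ∀ s : Multiset ℂ, (∀ z ∈ s, 1 < ‖z‖) → s ≠ 0 → 1 < ‖s.prod‖ := by
    intro s
    induction s using Multiset.induction_on with
    | empty => simp
    | cons a s ih =>
      intro h _
      rw [Multiset.prod_cons, norm_mul]
      have ha := h a (Multiset.mem_cons_self a s)
      by_cases hs0 : s = 0
      · simpa [hs0] using ha
      · exact one_lt_mul_of_lt_of_le ha
          (ih (fun z hz => h z (Multiset.mem_cons_of_mem hz)) hs0).le
  have h1 := hs.coeff_zero_eq_prod_roots_of_monic hPm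
  have h2 : ‖P.coeff 0‖ = 1 := by
    rw [hP, coeff_map]
    rcases Int.isUnit_iff.mp h0 with h | h <;> simp [h]
  rw [h1, norm_mul, norm_pow, norm_neg, norm_one, one_pow, one_mul] at h2
  exact (hprod _ hroots hcard).ne' h2

-- Every nontrivial monic factor has a root in the closed unit disc, that is, x or -x, and both are
-- simple. So the polynomial is either irreducible or a product of the minimal polynomials G of x
-- and H of -x. In the second case H(X) = ±G(-X), and the value 2 at X = 1 equals ±G(1)G(-1). The
-- two factors have the same parity, so their product is odd or divisible by 4.
open Polynomial in
theorem irreducible_evenTrinomial {N : ℕ} (hN : 2 ≤ N) : Irreducible (evenTrinomial N) := by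
  have hN0 : N ≠ 0 := by omega
  obtain ⟨y, hy0, hy1, hy⟩ := exists_small_root hN0
  obtain ⟨x, hx0, rfl⟩ : ∃ x : ℝ, 0 < x ∧ x ^ 2 = y := ⟨√y, by positivity, Real.sq_sqrt hy0.le⟩
  set f := evenTrinomial N with hf
  have hfm : f.Monic := evenTrinomial_monic hN
  have hy' : ((x : ℂ) ^ 2) ^ N + 2 * (x : ℂ) ^ 2 = 1 := by exact_mod_cast hy
  have hr1 : aeval (x : ℂ) f = 0 := by
    rw [hf, aeval_evenTrinomial]; linear_combination hy'
  have hr2 : aeval (-x : ℂ) f = 0 := by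
    rw [hf, aeval_evenTrinomial, neg_sq]; linear_combination hy'
  have hf0 : f.coeff 0 = -1 := by
    rw [coeff_zero_eq_eval_zero]; simp [hf, evenTrinomial, hN0]
  have hsimple : ∀ z : ℂ, z ^ 2 = x ^ 2 → aeval z (derivative f) ≠ 0 := by
    intro z hz h
    -- Multiplying by z makes the value depend on z^2 = x^2 only, where it is a positive real.
    have h2 : z * aeval z (derivative f) = 2 * (N * (z ^ 2) ^ N + 2 * z ^ 2) := by
      simp only [hf, evenTrinomial, derivative_X_pow, derivative_mul, derivative_one, derivative_ofNat, map_add, map_sub, map_mul, map_pow,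
        aeval_X, map_zero, map_natCast, map_ofNat]
      have : z ^ (2 * N) = z * z ^ (2 * N - 1) := by
        rw [← pow_succ']; congr 1; omega
      rw [← pow_mul, this]
      push_cast
      ring
    rw [h, hz] at h2
    have h3 : (0 : ℝ) = 2 * (N * (x ^ 2) ^ N + 2 * x ^ 2) := by
      apply Complex.ofReal_injective
      push_cast
      simpa using h2
    have : 0 < 2 * (N * (x ^ 2) ^ N + 2 * x ^ 2) := by positivity
    exact this.ne h3
  have hint : ∀ z : ℂ, aeval z f = 0 → IsIntegral ℤ z := fun z hz => ⟨f, hfm, hz⟩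
  -- a cofactor of a divisor vanishing at both small roots is trivial
  have key : ∀ p q : ℤ[X], p.Monic → f = p * q → aeval (x : ℂ) p = 0 → aeval (-x : ℂ) p = 0 →
      q = 1 := by
    intro p q hp hpq h1 h2
    have hq : q.Monic := hp.of_mul_monic_left (hpq ▸ hfm)
    by_contra hq1
    have hu : IsUnit (q.coeff 0) := by
      refine isUnit_of_dvd_unit (y := (-1 : ℤ)) ?_ (by simp)
      rw [← hf0, hpq, mul_coeff_zero]
      exact dvd_mul_left _ _
    obtain ⟨z, hz1, hz⟩ := exists_root_norm_le_one hq hq1 hu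
    have hzf : aeval z f = 0 := by rw [hpq, map_mul, hz, mul_zero]
    have hzx := root_evenTrinomial_of_norm_le_one hx0 hy1 hy hz1 hzf
    have hzp : aeval z p = 0 := by rcases hzx with rfl | rfl <;> assumption
    -- A common root of p and q would be a multiple root of f.
    refine hsimple z (by rcases hzx with rfl | rfl <;> ring) ?_
    rw [hpq, derivative_mul, map_add, map_mul, map_mul, hz, hzp]
    ring
  set G := minpoly ℤ (x : ℂ) with hG
  have hGm : G.Monic := minpoly.monic (hint _ hr1)
  have hGx : aeval (x : ℂ) G = 0 := minpoly.aeval _ _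
  obtain ⟨r, hr⟩ := minpoly.isIntegrallyClosed_dvd (hint _ hr1) hr1
  by_cases hGx' : aeval (-x : ℂ) G = 0
  · have h := key G r hGm hr hGx hGx'
    rw [hr, h, mul_one]
    exact minpoly.irreducible (hint _ hr1)
  · exfalso
    have hrx : aeval (-x : ℂ) r = 0 := by
      have h := hr2
      rw [hr, map_mul] at h
      exact (mul_eq_zero.mp h).resolve_left hGx'
    set H := minpoly ℤ (-x : ℂ) with hH
    obtain ⟨q, hq⟩ := minpoly.isIntegrallyClosed_dvd (hint _ hr2) hrx
    have h := key (G * H) q (hGm.mul (minpoly.monic (hint _ hr2)))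
      (by rw [mul_assoc, ← hq]; exact hr) (by rw [map_mul, hGx, zero_mul])
      (by rw [map_mul, minpoly.aeval, mul_zero])
    have hfGH : f = G * H := by rw [hr, hq, h, mul_one]
    have hneg : ∀ {u v : ℂ}, IsIntegral ℤ u → IsIntegral ℤ v → u = -v →
        minpoly ℤ u ∣ (minpoly ℤ v).comp (-X) := by
      intro u v hu hv huv
      refine minpoly.isIntegrallyClosed_dvd hu ?_
      rw [aeval_comp, map_neg, aeval_X, huv, neg_neg, minpoly.aeval]
    have hd : H.eval 1 ∣ G.eval (-1) := by
      obtain ⟨c, hc⟩ := hneg (hint _ hr2) (hint _ hr1) rfl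
      have := congrArg (eval 1) hc
      rw [eval_comp, eval_mul, eval_neg, eval_X] at this
      exact ⟨_, this⟩
    have hd' : G.eval (-1) ∣ H.eval 1 := by
      obtain ⟨c, hc⟩ := hneg (hint _ hr1) (hint _ hr2) (neg_neg _).symm
      have := congrArg (eval (-1)) hc
      rw [eval_comp, eval_mul, eval_neg, eval_X, neg_neg] at this
      exact ⟨_, this⟩
    have hf1 : f.eval 1 = 2 := by simp [hf, evenTrinomial]
    rw [hfGH, eval_mul] at hf1
    have hpar : (1 - (-1) : ℤ) ∣ G.eval 1 - G.eval (-1) := sub_dvd_eval_sub _ _ _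
    rcases Int.natAbs_eq_natAbs_iff.mp (Int.natAbs_eq_of_dvd_dvd hd hd') with h' | h' <;>
    · rw [h'] at hf1
      obtain ⟨c, hc⟩ := hpar
      have h2 : G.eval 1 = G.eval (-1) + 2 * c := by linarith
      rw [h2] at hf1
      rcases Int.even_or_odd' (G.eval (-1)) with ⟨e, he | he⟩ <;> rw [he] at hf1 <;> ring_nf at hf1 <;> omega

/-! ### Extensions in which real embeddings stay real -/

theorem natDegree_prod_range_X_sub_C {S : Type*} [CommRing S] [Nontrivial S] (m : ℕ) (u : ℕ → S) :
    (∏ i ∈ Finset.range m, (Polynomial.X - Polynomial.C (u i))).natDegree = m := by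
  rw [Polynomial.natDegree_prod_of_monic _ _ fun i _ => Polynomial.monic_X_sub_C _]
  simp only [Polynomial.natDegree_X_sub_C, Finset.sum_const, Finset.card_range, smul_eq_mul,
    mul_one]

/-- A polynomial `∏ i < m, (X - R * i) + c` with `R` large compared to `c` has only real roots. -/
theorem eq_ofReal_of_prod_sub_add_eq_zero {m : ℕ} (hm : m ≠ 0) {R c : ℝ} (hR : 2 ≤ R)
    (hc : |c| < R / 2) {z : ℂ} (hz : ∏ i ∈ Finset.range m, (z - R * i) + c = 0) :
    ∃ r : ℝ, z = r := by
  set h : ℝ → ℝ := fun t => ∏ i ∈ Finset.range m, (t - R * i) with hh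
  have hcont : Continuous fun t => h t + c := by
    simp only [hh]
    fun_prop
  -- At points halfway between consecutive multiples of R each factor is at least R/2 ≥ 1 in
  -- absolute value, so adding c does not change the sign there.
  have hbig : ∀ j : ℤ, |c| < |h (R * (j - 1 / 2))| := by
    intro j
    refine hc.trans_le ?_
    calc R / 2 ≤ (R / 2) ^ m := le_self_pow₀ (by linarith) hm
      _ = ∏ i ∈ Finset.range m, R / 2 := by rw [Finset.prod_const, Finset.card_range]
      _ ≤ ∏ i ∈ Finset.range m, |R * (j - 1 / 2) - R * i| := by
        refine Finset.prod_le_prod (fun _ _ => by positivity) fun i _ => ?_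
        have h1 : R * ((j : ℝ) - 1 / 2) - R * i = R * (((j - i : ℤ) : ℝ) - 1 / 2) := by
          push_cast; ring
        rw [h1, abs_mul, abs_of_pos (by linarith : 0 < R), div_eq_mul_one_div]
        refine mul_le_mul_of_nonneg_left ?_ (by linarith)
        rcases le_or_gt (j - i : ℤ) 0 with hji | hji
        · have : ((j - i : ℤ) : ℝ) ≤ 0 := by exact_mod_cast hji
          rw [abs_of_neg (by linarith)]
          linarith
        · have : (1 : ℝ) ≤ ((j - i : ℤ) : ℝ) := by exact_mod_cast hji
          rw [abs_of_pos (by linarith)]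
          linarith
      _ = |h (R * (j - 1 / 2))| := by rw [hh, Finset.abs_prod]
  -- Factor i contributes R^2((j - i)^2 - 1/4), which is negative only for i = j.
  have halt : ∀ j ∈ Finset.range m, h (R * (j - 1 / 2)) * h (R * (j + 1 / 2)) < 0 := by
    intro j hj
    simp only [hh, ← Finset.prod_mul_distrib]
    rw [← Finset.mul_prod_erase _ _ hj]
    refine mul_neg_of_neg_of_pos (by nlinarith) (Finset.prod_pos fun i hi => ?_)
    have hne : ((j : ℤ) - i) ≠ 0 := by
      have := Finset.ne_of_mem_erase hi
      omega
    have h1 : (1 : ℝ) ≤ ((j : ℝ) - i) ^ 2 := by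
      have := Int.one_le_abs hne
      have h2 : (1 : ℤ) ≤ ((j : ℤ) - i) ^ 2 := by
        rw [← sq_abs]; nlinarith
      exact_mod_cast h2
    have h3 : (R * (j - 1 / 2) - R * i) * (R * (j + 1 / 2) - R * i) =
        R ^ 2 * (((j : ℝ) - i) ^ 2 - 1 / 4) := by ring
    rw [h3]
    exact mul_pos (by positivity) (by linarith)
  have hroot : ∀ j ∈ Finset.range m, ∃ r : ℝ, R * (j - 1 / 2) < r ∧ r < R * (j + 1 / 2) ∧
      h r + c = 0 := by
    intro j hj
    have hlt : R * ((j : ℝ) - 1 / 2) ≤ R * (j + 1 / 2) := by nlinarith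
    have h1 := hbig j
    have h2 := hbig (j + 1)
    have h3 : (((j + 1 : ℤ) : ℝ) - 1 / 2) = (j : ℝ) + 1 / 2 := by push_cast; ring
    rw [h3] at h2
    have h4 : (((j : ℕ) : ℤ) : ℝ) = j := Int.cast_natCast j
    rw [h4] at h1
    have hcc := abs_le.mp (le_refl |c|)
    rcases mul_neg_iff.mp (halt j hj) with ⟨hp, hn⟩ | ⟨hn, hp⟩
    · rw [abs_of_pos hp] at h1
      rw [abs_of_neg hn] at h2
      obtain ⟨r, hr, hr0⟩ := intermediate_value_Ioo' hlt hcont.continuousOn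
        (show (0 : ℝ) ∈ Set.Ioo _ _ from ⟨by linarith, by linarith⟩)
      exact ⟨r, hr.1, hr.2, hr0⟩
    · rw [abs_of_neg hn] at h1
      rw [abs_of_pos hp] at h2
      obtain ⟨r, hr, hr0⟩ := intermediate_value_Ioo hlt hcont.continuousOn
        (show (0 : ℝ) ∈ Set.Ioo _ _ from ⟨by linarith, by linarith⟩)
      exact ⟨r, hr.1, hr.2, hr0⟩
  choose! r hr1 hr2 hr3 using hroot
  have hinj : Set.InjOn (fun j => (r j : ℂ)) (Finset.range m) := by
    have key : ∀ i ∈ Finset.range m, ∀ j ∈ Finset.range m, i < j → r i < r j := by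
      intro i hi j hj hij
      have h1 : (i : ℝ) + 1 ≤ j := by exact_mod_cast hij
      have h2 := hr2 i hi
      have h3 := hr1 j hj
      nlinarith
    intro i hi j hj hij
    have hij' : r i = r j := Complex.ofReal_injective hij
    rcases lt_trichotomy i j with h | h | h
    · exact absurd hij' (key i hi j hj h).ne
    · exact h
    · exact absurd hij' (key j hj i hi h).ne'
  by_contra! hcon
  set q : Polynomial ℂ := ∏ i ∈ Finset.range m, (Polynomial.X - Polynomial.C ((R : ℂ) * i)) with hq
  have hqm : q.Monic := Polynomial.monic_prod_of_monic _ _ fun i _ => Polynomial.monic_X_sub_C _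
  have hqd : q.natDegree = m := natDegree_prod_range_X_sub_C m _
  set p : Polynomial ℂ := q + Polynomial.C (c : ℂ) with hp
  have hpd : p.natDegree = m := by rw [hp, Polynomial.natDegree_add_C, hqd]
  have hp0 : p ≠ 0 := by
    intro h0
    rw [h0, Polynomial.natDegree_zero] at hpd
    exact hm hpd.symm
  have heval : ∀ w : ℂ, p.eval w = ∏ i ∈ Finset.range m, (w - R * i) + c := by
    intro w
    simp [hp, hq, Polynomial.eval_prod]
  -- The sign changes already give m real roots; a non-real z would be one root too many.
  have hsub : insert z ((Finset.range m).image fun j => (r j : ℂ)) ⊆ p.roots.toFinset := by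
    intro w hw
    rw [Multiset.mem_toFinset, Polynomial.mem_roots hp0, Polynomial.IsRoot, heval]
    rcases Finset.mem_insert.mp hw with rfl | hw
    · exact hz
    · obtain ⟨j, hj, rfl⟩ := Finset.mem_image.mp hw
      have := hr3 j hj
      simp only [hh] at this
      exact_mod_cast congrArg ((↑) : ℝ → ℂ) this
  have h1 := (Finset.card_le_card hsub).trans ((Multiset.toFinset_card_le _).trans
    (Polynomial.card_roots' p))
  rw [Finset.card_insert_of_notMem, Finset.card_image_of_injOn hinj, Finset.card_range, hpd] at h1
  · omega
  · intro h
    obtain ⟨j, _, hj⟩ := Finset.mem_image.mp h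
    exact hcon _ hj.symm

open NumberField in
/-- Eisenstein polynomials with prescribed real behaviour. -/
theorem exists_eisenstein_prod_add (F : Type*) [Field F] [NumberField F] {m : ℕ} (hm : m ≠ 0) :
    ∃ (R : ℕ) (c : F), 2 ≤ R ∧ (∀ φ : F →+* ℂ, ‖φ c‖ < R / 2) ∧
      Irreducible (∏ i ∈ Finset.range m, (Polynomial.X - Polynomial.C ((R : F) * i)) +
        Polynomial.C c) := by
  obtain ⟨P, hP⟩ := Ideal.exists_maximal (𝓞 F)
  have hP0 : P ≠ ⊥ := Ring.ne_bot_of_isMaximal_of_not_isField hP (RingOfIntegers.not_isField F)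
  obtain ⟨π, hπ1, hπ2⟩ := P.exists_mem_pow_notMem_pow_succ hP0 hP.ne_top 1
  rw [pow_one] at hπ1
  obtain ⟨B, hB⟩ : ∃ B : ℕ, ∀ φ : F →+* ℂ, ‖φ (π : F)‖ < B := by
    obtain ⟨B, hB⟩ := exists_nat_gt (∑ φ : F →+* ℂ, ‖φ (π : F)‖)
    exact ⟨B, fun φ => (Finset.single_le_sum (f := fun φ : F →+* ℂ => ‖φ (π : F)‖)
      (fun _ _ => norm_nonneg _) (Finset.mem_univ φ)).trans_lt hB⟩
  have hA : 1 ≤ Ideal.absNorm P := Nat.one_le_iff_ne_zero.mpr (Ideal.absNorm_eq_zero_iff.not.mpr hP0)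
  -- The factor `Ideal.absNorm P` puts R in P, so the product reduces to X^m modulo P; the factor
  -- 2(B + 1) makes R/2 exceed every conjugate of π. The constant term is exactly π, in P but not in
  -- P^2, because the factor for i = 0 is X.
  set R : ℕ := 2 * (B + 1) * Ideal.absNorm P with hR
  have hRP : (R : 𝓞 F) ∈ P := by
    rw [hR]
    push_cast
    exact Ideal.mul_mem_left _ _ (Ideal.absNorm_mem P)
  have hR' : 2 * (B + 1) ≤ R := Nat.le_mul_of_pos_right _ hA
  refine ⟨R, π, by omega, fun φ => (hB φ).trans_le ?_, ?_⟩
  · have : (2 * (B + 1) : ℝ) ≤ R := by exact_mod_cast hR'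
    linarith
  set g : Polynomial (𝓞 F) := ∏ i ∈ Finset.range m,
    (Polynomial.X - Polynomial.C ((R : 𝓞 F) * i)) with hg
  have hgm : g.Monic := Polynomial.monic_prod_of_monic _ _ fun i _ => Polynomial.monic_X_sub_C _
  have hgd : g.natDegree = m := natDegree_prod_range_X_sub_C m _
  have hgm' : (g + Polynomial.C π).Monic := hgm.add_of_left (by
    refine lt_of_le_of_lt Polynomial.degree_C_le ?_
    rw [Polynomial.degree_eq_natDegree hgm.ne_zero, hgd]
    exact_mod_cast Nat.pos_of_ne_zero hm)
  have hgd' : (g + Polynomial.C π).natDegree = m := by rw [Polynomial.natDegree_add_C, hgd]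
  have hmap : (g + Polynomial.C π).map (algebraMap (𝓞 F) F) =
      ∏ i ∈ Finset.range m, (Polynomial.X - Polynomial.C ((R : F) * i)) +
        Polynomial.C (π : F) := by
    simp [hg, Polynomial.map_prod]
  rw [← hmap, ← hgm'.irreducible_iff_irreducible_map_fraction_map]
  have hred : g.map (Ideal.Quotient.mk P) = Polynomial.X ^ m := by
    have h0 : Ideal.Quotient.mk P (R : 𝓞 F) = 0 := Ideal.Quotient.eq_zero_iff_mem.mpr hRP
    simp only [hg, Polynomial.map_prod, Polynomial.map_sub, Polynomial.map_X, Polynomial.map_C,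
      RingHom.map_mul (Ideal.Quotient.mk P), h0, zero_mul, map_zero, sub_zero, Finset.prod_const,
      Finset.card_range]
  have hg0 : g.coeff 0 = 0 := by
    rw [Polynomial.coeff_zero_eq_eval_zero, hg, Polynomial.eval_prod]
    exact Finset.prod_eq_zero (Finset.mem_range.mpr (Nat.pos_of_ne_zero hm)) (by simp)
  refine (hgm'.isEisensteinAt_of_mem_of_notMem hP.ne_top (fun {n} hn => ?_) ?_).irreducible
    hP.isPrime hgm'.isPrimitive (by rw [hgd']; exact Nat.pos_of_ne_zero hm)
  · rw [hgd'] at hn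
    have h1 : g.coeff n ∈ P := by
      rw [← Ideal.Quotient.eq_zero_iff_mem, ← Polynomial.coeff_map, hred, Polynomial.coeff_X_pow,
        if_neg hn.ne]
    rw [Polynomial.coeff_add, Polynomial.coeff_C]
    split_ifs
    · exact P.add_mem h1 hπ1
    · rwa [add_zero]
  · rw [Polynomial.coeff_add, hg0, zero_add, Polynomial.coeff_C_zero]
    exact hπ2

open NumberField ComplexEmbedding in
/-- A number field has extensions of every degree in which all real embeddings extend only to real
embeddings. -/
theorem exists_extension_isReal (F : Type) [Field F] [NumberField F] {m : ℕ} (hm : m ≠ 0) :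
    ∃ (K : Type) (_ : Field K) (_ : NumberField K) (_ : Algebra F K),
      Module.finrank F K = m ∧
        ∀ φ : K →+* ℂ, IsReal (φ.comp (algebraMap F K)) → IsReal φ := by
  obtain ⟨R, c, hR, hc, hirr⟩ := exists_eisenstein_prod_add F hm
  set g : Polynomial F := ∏ i ∈ Finset.range m, (Polynomial.X - Polynomial.C ((R : F) * i)) +
        Polynomial.C c with hg
  have : Fact (Irreducible g) := ⟨hirr⟩
  have hgd : g.natDegree = m := by
    rw [hg, Polynomial.natDegree_add_C, natDegree_prod_range_X_sub_C]
  have hfin : FiniteDimensional F (AdjoinRoot g) := (AdjoinRoot.powerBasis hirr.ne_zero).finite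
  have hfinQ : FiniteDimensional ℚ (AdjoinRoot g) := FiniteDimensional.trans ℚ F _
  have hnf : NumberField (AdjoinRoot g) :=
    { to_charZero := charZero_of_injective_algebraMap (algebraMap F (AdjoinRoot g)).injective
      to_finiteDimensional := by
        convert hfinQ }
  refine ⟨AdjoinRoot g, inferInstance, hnf, inferInstance, ?_, fun φ hφ => ?_⟩
  · rw [(AdjoinRoot.powerBasis hirr.ne_zero).finrank, AdjoinRoot.powerBasis_dim, hgd]
  · obtain ⟨r, hr⟩ : ∃ r : ℝ, (φ.comp (algebraMap F (AdjoinRoot g))) c = r := by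
      have := RingHom.congr_fun (ComplexEmbedding.isReal_iff.mp hφ) c
      rw [conjugate_coe_eq] at this
      exact ⟨_, (Complex.conj_eq_iff_real.mp this).choose_spec⟩
    have hz : ∏ i ∈ Finset.range m, (φ (AdjoinRoot.root g) - (R : ℝ) * i) + (r : ℂ) = 0 := by
      have h0 := AdjoinRoot.eval₂_root g
      have h1 := congrArg φ h0
      rw [Polynomial.hom_eval₂, map_zero] at h1
      have h2 := (congrArg (Polynomial.eval₂ (φ.comp (AdjoinRoot.of g)) (φ (AdjoinRoot.root g)))
        hg).symm.trans h1
      have hr' : (φ.comp (AdjoinRoot.of g)) c = r := hr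
      rw [Polynomial.eval₂_add, Polynomial.eval₂_C, Polynomial.eval₂_finsetProd, hr'] at h2
      simpa using h2
    have hrc : |r| < (R : ℝ) / 2 := by
      have := hc (φ.comp (algebraMap F (AdjoinRoot g)))
      rwa [hr, Complex.norm_real, Real.norm_eq_abs] at this
    obtain ⟨x, hx⟩ := eq_ofReal_of_prod_sub_add_eq_zero hm (by exact_mod_cast hR) hrc hz
    rw [ComplexEmbedding.isReal_iff]
    refine AdjoinRoot.ringHom_ext ?_ ?_
    · exact ComplexEmbedding.isReal_iff.mp hφ
    · rw [conjugate_coe_eq, hx, Complex.conj_ofReal]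

open NumberField ComplexEmbedding in
/-- If the real embeddings of `F` extend only to real embeddings of `K`, then the number of real
embeddings is multiplied by the degree. -/
theorem card_isReal_eq_finrank_mul (F K : Type*) [Field F] [NumberField F] [Field K]
    [NumberField K] [Algebra F K]
    (h : ∀ φ : K →+* ℂ, IsReal (φ.comp (algebraMap F K)) → IsReal φ) :
    Nat.card {φ : K →+* ℂ // IsReal φ} =
      Nat.card {φ : F →+* ℂ // IsReal φ} * Module.finrank F K := by
  classical
  let res : {φ : K →+* ℂ // IsReal φ} → {φ : F →+* ℂ // IsReal φ} :=
    fun φ => ⟨φ.1.comp (algebraMap F K), φ.2.comp _⟩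
  -- With ℂ viewed as an F-algebra through ψ, the fibre is the set of F-algebra maps K → ℂ; `h`
  -- ensures that all of them are real.
  have hfib : ∀ ψ, Nat.card {φ // res φ = ψ} = Module.finrank F K := by
    intro ψ
    let := ψ.1.toAlgebra
    rw [← AlgHom.card F K ℂ, ← Nat.card_eq_fintype_card]
    refine Nat.card_congr
      { toFun := fun φ => { φ.1.1 with
          commutes' := fun x => RingHom.congr_fun (congrArg Subtype.val φ.2) x }
        invFun := fun φ => ⟨⟨φ, h _ ?_⟩, Subtype.ext ?_⟩
        left_inv := fun φ => rfl
        right_inv := fun φ => rfl }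
    · have : (φ : K →+* ℂ).comp (algebraMap F K) = ψ.1 := φ.comp_algebraMap
      rw [this]
      exact ψ.2
    · exact φ.comp_algebraMap
  rw [Nat.card_congr (Equiv.sigmaFiberEquiv res).symm, Nat.card_sigma, Finset.sum_congr rfl
    (fun ψ _ => hfib ψ), Finset.sum_const, smul_eq_mul, Finset.card_univ, Nat.card_eq_fintype_card]

/-! ### The field generated by a root of the trinomial -/

open NumberField ComplexEmbedding Polynomial in
/-- The field generated by a root of `evenTrinomial N` has exactly two real embeddings. -/
theorem exists_field_root_evenTrinomial {N : ℕ} (hN : 2 ≤ N) :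
    ∃ (F : Type) (_ : Field F) (_ : NumberField F) (a : F),
      Module.finrank ℚ F = 2 * N ∧ (a ^ 2) ^ N + 2 * a ^ 2 = 1 ∧
        Nat.card {φ : F →+* ℂ // IsReal φ} = 2 ∧
          ∀ φ : F →+* ℂ, (∃ r : ℝ, φ a = r) → IsReal φ := by
  have hN0 : N ≠ 0 := by omega
  obtain ⟨y, hy0, hy1, hy⟩ := exists_small_root hN0
  obtain ⟨x, hx0, rfl⟩ : ∃ x : ℝ, 0 < x ∧ x ^ 2 = y := ⟨√y, by positivity, Real.sq_sqrt hy0.le⟩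
  have hm := evenTrinomial_monic hN
  set f : ℚ[X] := (evenTrinomial N).map (algebraMap ℤ ℚ) with hf
  have hirr : Irreducible f :=
    (hm.irreducible_iff_irreducible_map_fraction_map (K := ℚ)).mp (irreducible_evenTrinomial hN)
  have : Fact (Irreducible f) := ⟨hirr⟩
  have hfin : FiniteDimensional ℚ (AdjoinRoot f) := (AdjoinRoot.powerBasis hirr.ne_zero).finite
  have hnf : NumberField (AdjoinRoot f) :=
    { to_charZero := charZero_of_injective_algebraMap (algebraMap ℚ (AdjoinRoot f)).injective
      to_finiteDimensional := by convert hfin }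
  have hext : ∀ φ ψ : AdjoinRoot f →+* ℂ, φ (AdjoinRoot.root f) = ψ (AdjoinRoot.root f) →
      φ = ψ := by
    intro φ ψ h
    exact AdjoinRoot.ringHom_ext (Subsingleton.elim _ _) h
  have hreal : ∀ φ : AdjoinRoot f →+* ℂ, (∃ r : ℝ, φ (AdjoinRoot.root f) = r) → IsReal φ := by
    rintro φ ⟨r, hr⟩
    rw [ComplexEmbedding.isReal_iff]
    refine hext _ _ ?_
    rw [conjugate_coe_eq, hr, Complex.conj_ofReal]
  have hroot : (AdjoinRoot.root f ^ 2) ^ N + 2 * AdjoinRoot.root f ^ 2 = 1 := by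
    have h := AdjoinRoot.eval₂_root f
    have hf' : f = X ^ (2 * N) + (2 * X ^ 2 - 1) := by
      simp [hf, evenTrinomial]
    have h2 := (congrArg (eval₂ (AdjoinRoot.of f) (AdjoinRoot.root f)) hf').symm.trans h
    simp only [eval₂_add, eval₂_sub, eval₂_mul, eval₂_X_pow, eval₂_one, eval₂_ofNat] at h2
    rw [← pow_mul]
    linear_combination h2
  refine ⟨AdjoinRoot f, inferInstance, hnf, AdjoinRoot.root f, ?_, hroot, ?_, hreal⟩
  · have : Module.finrank ℚ (AdjoinRoot f) = 2 * N := by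
      rw [(AdjoinRoot.powerBasis hirr.ne_zero).finrank, AdjoinRoot.powerBasis_dim, hf,
        hm.natDegree_map, natDegree_evenTrinomial hN]
    convert this
  · have hy' : ((x : ℂ) ^ 2) ^ N + 2 * (x : ℂ) ^ 2 = 1 := by exact_mod_cast hy
    have hex : ∀ z : ℂ, z ^ 2 = x ^ 2 → ∃ φ : AdjoinRoot f →+* ℂ, φ (AdjoinRoot.root f) = z := by
      intro z hz
      refine ⟨AdjoinRoot.lift (algebraMap ℚ ℂ) z ?_, AdjoinRoot.lift_root _⟩
      rw [← aeval_def, hf, aeval_map_algebraMap, aeval_evenTrinomial, hz]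
      linear_combination hy'
    obtain ⟨φ₁, h₁⟩ := hex x rfl
    obtain ⟨φ₂, h₂⟩ := hex (-x) (neg_sq _)
    have hne : φ₁ ≠ φ₂ := by
      rintro rfl
      rw [h₁] at h₂
      have : (x : ℂ) ≠ 0 := by exact_mod_cast hx0.ne'
      exact this (self_eq_neg.mp h₂)
    have hset : {φ : AdjoinRoot f →+* ℂ | IsReal φ} = {φ₁, φ₂} := by
      ext φ
      constructor
      · intro hφ
        have h3 := RingHom.congr_fun (ComplexEmbedding.isReal_iff.mp hφ) (AdjoinRoot.root f)
        rw [conjugate_coe_eq] at h3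
        obtain ⟨r, hr⟩ := Complex.conj_eq_iff_real.mp h3
        have h4 : aeval (r : ℂ) (evenTrinomial N) = 0 := by
          have h5 := congrArg φ hroot
          simp only [map_add, map_mul, map_pow, map_ofNat, map_one, hr] at h5
          rw [aeval_evenTrinomial]
          linear_combination h5
        have h5 : (r ^ 2) ^ N + 2 * r ^ 2 = 1 := by
          rw [aeval_evenTrinomial] at h4
          have : (((r ^ 2) ^ N + 2 * r ^ 2 - 1 : ℝ) : ℂ) = 0 := by push_cast; exact h4
          linarith [Complex.ofReal_eq_zero.mp this]
        -- The equation forces 2r^2 ≤ 1, so every real root lies in the disc and is ±x.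
        have h6 : ‖(r : ℂ)‖ ≤ 1 := by
          rw [Complex.norm_real, Real.norm_eq_abs, ← sq_le_one_iff_abs_le_one]
          have : 0 ≤ (r ^ 2) ^ N := by positivity
          nlinarith
        rcases root_evenTrinomial_of_norm_le_one hx0 hy1 hy h6 h4 with h7 | h7
        · exact Or.inl (hext _ _ (by rw [hr, h7, h₁]))
        · exact Or.inr (hext _ _ (by rw [hr, h7, h₂]))
      · rintro (rfl | rfl)
        · exact hreal _ ⟨x, h₁⟩
        · exact hreal _ ⟨-x, by rw [h₂]; simp⟩
    have := Set.ncard_pair hne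
    rw [← hset] at this
    exact this

/-! ### Sums over infinite places and bounds for the minimum distance -/

section

open NumberField InfinitePlace

-- The weights 2 - mult and mult - 1 are the indicators of the real and complex places, which lets
-- both kinds share one termwise estimate.
open scoped Classical in
theorem sum_mult_affine (K : Type*) [Field K] [NumberField K] (A B : ℝ) :
    ∑ w : InfinitePlace K, ((2 - w.mult) * A + (w.mult - 1) * B) =
      nrRealPlaces K * A + nrComplexPlaces K * B := by
  have h1 : ((∑ w : InfinitePlace K, w.mult : ℕ) : ℝ) = nrRealPlaces K + 2 * nrComplexPlaces K := by
    rw [sum_mult_eq, ← card_add_two_mul_card_eq_rank]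
    push_cast
    ring
  have h2 : (Fintype.card (InfinitePlace K) : ℝ) = nrRealPlaces K + nrComplexPlaces K := by
    rw [card_eq_nrRealPlaces_add_nrComplexPlaces]
    push_cast
    ring
  push_cast at h1
  rw [Finset.sum_add_distrib, ← Finset.sum_mul, ← Finset.sum_mul, Finset.sum_sub_distrib,
    Finset.sum_sub_distrib, h1, Finset.sum_const, Finset.sum_const, Finset.card_univ, nsmul_eq_mul,
    nsmul_eq_mul, h2]
  ring

theorem sum_mult_mul_log_nonneg {K : Type*} [Field K] [NumberField K] {a : 𝓞 K} (ha : a ≠ 0) :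
    0 ≤ ∑ w : InfinitePlace K, w.mult * Real.log (w (a : K)) := by
  have ha' : (a : K) ≠ 0 := by simpa using ha
  have h1 : (1 : ℝ) ≤ ∏ w : InfinitePlace K, w (a : K) ^ w.mult := by
    rw [prod_eq_abs_norm, ← Algebra.coe_norm_int, ← Int.cast_abs, Rat.cast_intCast]
    exact_mod_cast Int.one_le_abs (Algebra.norm_ne_zero_iff.mpr ha)
  have h2 := Real.log_nonneg h1
  rw [Real.log_prod fun w _ => pow_ne_zero _ (pos_iff.mpr ha').ne'] at h2
  simpa only [Real.log_pow] using h2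

theorem mult_eq_one_or_two {K : Type*} [Field K] (w : InfinitePlace K) :
    (w.IsReal ∧ (w.mult : ℝ) = 1) ∨ (w.IsComplex ∧ (w.mult : ℝ) = 2) := by
  rcases isReal_or_isComplex w with h | h
  · exact Or.inl ⟨h, by rw [h.mult_eq_one, Nat.cast_one]⟩
  · exact Or.inr ⟨h, by rw [h.mult_eq_two, Nat.cast_ofNat]⟩

open scoped Classical in
/-- The arithmetic-geometric mean inequality for the conjugates of an algebraic integer. -/
theorem le_sum_sq_apply {K : Type*} [Field K] [NumberField K] {a : 𝓞 K} (ha : a ≠ 0) :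
    (Module.finrank ℚ K : ℝ) / 2 * (2 : ℝ) ^ ((nrRealPlaces K : ℝ) / Module.finrank ℚ K) ≤
      ∑ w : InfinitePlace K, w (a : K) ^ 2 := by
  set n : ℝ := (Module.finrank ℚ K : ℝ) with hn
  have hn0 : 0 < n := by rw [hn]; exact_mod_cast Module.finrank_pos
  have hst : (nrRealPlaces K : ℝ) + 2 * nrComplexPlaces K = n := by
    rw [hn]
    exact_mod_cast card_add_two_mul_card_eq_rank K
  have ha' : (a : K) ≠ 0 := by simpa using ha
  -- In the equality case the squared absolute values are c at real places and 2c at complex ones;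
  -- norm 1 then forces this c.
  set c : ℝ := (2 : ℝ) ^ ((nrRealPlaces K : ℝ) / n) / 2 with hc
  have hc0 : 0 < c := by positivity
  have hlogc : n * Real.log c = -(2 * nrComplexPlaces K * Real.log 2) := by
    rw [hc, Real.log_div (by positivity) (by norm_num), Real.log_rpow (by norm_num), mul_sub,
      ← mul_assoc, mul_div_cancel₀ _ hn0.ne', ← hst]
    ring
  -- The mean inequality is obtained by summing log v ≤ v - 1, tangent at the equality case.
  have hw : ∀ w : InfinitePlace K, (w.mult : ℝ) * (1 - Real.log c) +
      2 * (w.mult * Real.log (w (a : K))) - ((2 - w.mult) * 0 + (w.mult - 1) * (2 * Real.log 2)) ≤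
        c⁻¹ * w (a : K) ^ 2 := by
    intro w
    have hpos : 0 < w (a : K) := pos_iff.mpr ha'
    rcases mult_eq_one_or_two w with ⟨-, h⟩ | ⟨-, h⟩
    · have h1 := Real.log_le_sub_one_of_pos (x := c⁻¹ * w (a : K) ^ 2) (by positivity)
      rw [Real.log_mul (by positivity) (by positivity), Real.log_inv, Real.log_pow] at h1
      push_cast at h1
      rw [h]
      linarith
    · have h1 := Real.log_le_sub_one_of_pos (x := c⁻¹ * w (a : K) ^ 2 / 2) (by positivity)
      rw [Real.log_div (by positivity) (by norm_num), Real.log_mul (by positivity) (by positivity),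
        Real.log_inv, Real.log_pow] at h1
      push_cast at h1
      rw [h]
      linarith
  have hsum := Finset.sum_le_sum fun w (_ : w ∈ Finset.univ) => hw w
  have hmult : ∑ w : InfinitePlace K, (w.mult : ℝ) = n := by
    rw [hn, ← sum_mult_eq]
    push_cast
    rfl
  rw [Finset.sum_sub_distrib, Finset.sum_add_distrib, ← Finset.sum_mul, ← Finset.mul_sum,
    ← Finset.mul_sum, sum_mult_affine, hmult] at hsum
  have h0 := sum_mult_mul_log_nonneg ha
  have h1 : n ≤ c⁻¹ * ∑ w : InfinitePlace K, w (a : K) ^ 2 := by linarith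
  calc n / 2 * (2 : ℝ) ^ ((nrRealPlaces K : ℝ) / n) = c * n := by rw [hc]; ring
    _ ≤ c * (c⁻¹ * ∑ w : InfinitePlace K, w (a : K) ^ 2) := by gcongr
    _ = _ := by rw [mul_inv_cancel_left₀ hc0.ne']

theorem vectorEmbedding_injective (K : Type*) [Field K] [NumberField K] :
    Function.Injective (vectorEmbedding K) := by
  classical
  rw [injective_iff_map_eq_zero]
  intro a ha
  have h := norm_vectorEmbedding_sq K a
  rw [ha, norm_zero, eq_comm, zero_pow two_ne_zero,
    Finset.sum_eq_zero_iff_of_nonneg (fun w _ => sq_nonneg _)] at h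
  obtain ⟨w⟩ := (inferInstance : Nonempty (InfinitePlace K))
  exact (map_eq_zero w).mp (pow_eq_zero_iff two_ne_zero |>.mp (h w (Finset.mem_univ w)))

open scoped Classical in
theorem exists_latticeMinDist_sq_eq (K : Type*) [Field K] [NumberField K] :
    ∃ a : 𝓞 K, a ≠ 0 ∧ latticeMinDist K ^ 2 = ∑ w : InfinitePlace K, w (a : K) ^ 2 := by
  obtain ⟨x, ⟨a, rfl⟩, hx0, hx⟩ := (latticeMinDist_isLeast K).1
  refine ⟨a, ?_, ?_⟩
  · rintro rfl
    exact hx0 (map_zero _)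
  · rw [← hx, ← norm_vectorEmbedding_sq]
    rfl

open scoped Classical in
theorem latticeMinDist_sq_le {K : Type*} [Field K] [NumberField K] {a : 𝓞 K} (ha : a ≠ 0) :
    latticeMinDist K ^ 2 ≤ ∑ w : InfinitePlace K, w (a : K) ^ 2 := by
  rw [← norm_vectorEmbedding_sq]
  have h : latticeMinDist K ≤ ‖vectorEmbedding K a‖ := by
    refine (latticeMinDist_isLeast K).2 ⟨_, ⟨a, rfl⟩, fun h => ha ?_, rfl⟩
    have h' : vectorEmbedding K (a : K) = vectorEmbedding K 0 := by rw [map_zero]; exact h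
    simpa using vectorEmbedding_injective K h'
  have h0 : 0 ≤ latticeMinDist K := by
    obtain ⟨x, -, -, hx⟩ := (latticeMinDist_isLeast K).1
    exact hx ▸ norm_nonneg x
  gcongr

theorem le_normalisedMinDistSq {L : Type*} [Field L] [NumberField L] {n s t : ℕ}
    (hn : Module.finrank ℚ L = n) (hst : HasSignature L s t) :
    (2 : ℝ) ^ ((s : ℝ) / n) / (1 + (s : ℝ) / n) ≤ normalisedMinDistSq L := by
  classical
  obtain ⟨a, ha, hd⟩ := exists_latticeMinDist_sq_eq L
  have h := le_sum_sq_apply ha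
  have hn0 : (0 : ℝ) < n := by rw [← hn]; exact_mod_cast Module.finrank_pos
  have hr : (s : ℝ) + 2 * t = n := by
    rw [← hn, ← hst.1, ← hst.2]
    exact_mod_cast card_add_two_mul_card_eq_rank L
  rw [← hd, hn, hst.1] at h
  rw [normalisedMinDistSq, hst.1, hst.2]
  have hs : (0 : ℝ) ≤ s := s.cast_nonneg
  have ht : (0 : ℝ) ≤ t := t.cast_nonneg
  rw [le_div_iff₀ (by linarith)]
  refine le_trans (le_of_eq ?_) h
  have : (t : ℝ) = (n - s) / 2 := by linarith
  rw [this]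
  have : (n : ℝ) + s ≠ 0 := by positivity
  field_simp
  ring

/-- A root of `evenTrinomial N` is a unit whose real conjugates have absolute value close to `1 / √2` and whose
non-real conjugates have absolute value slightly larger than `1`; its norm bounds the minimum
distance. -/
theorem latticeMinDist_sq_le_of_root {K : Type*} [Field K] [NumberField K] {N : ℕ} (hN : 3 ≤ N) {a : K}
    (ha : (a ^ 2) ^ N + 2 * a ^ 2 = 1)
    (hreal : ∀ φ : K →+* ℂ, (∃ r : ℝ, φ a = r) → ComplexEmbedding.IsReal φ) :
    latticeMinDist K ^ 2 ≤ nrRealPlaces K * (1 / 2 + Real.log 2 / 2 + 1 / N) +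
      nrComplexPlaces K * (1 + 4 / (N : ℝ) ^ 2) := by
  classical
  have hN0 : N ≠ 0 := by omega
  have hNpos : (0 : ℝ) < N := by positivity
  have hN3 : (3 : ℝ) ≤ N := by exact_mod_cast hN
  obtain ⟨y, hy0, hy1, hy⟩ := exists_small_root hN0
  obtain ⟨x, hx0, hxy⟩ : ∃ x : ℝ, 0 < x ∧ x ^ 2 = y := ⟨√y, by positivity, Real.sq_sqrt hy0.le⟩
  have hint : IsIntegral ℤ a := by
    refine ⟨evenTrinomial N, evenTrinomial_monic (by omega), ?_⟩
    simp only [evenTrinomial, Polynomial.eval₂_add, Polynomial.eval₂_sub, Polynomial.eval₂_mul,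
      Polynomial.eval₂_X_pow, Polynomial.eval₂_one, Polynomial.eval₂_ofNat]
    rw [pow_mul]
    linear_combination ha
  set b : 𝓞 K := ⟨a, hint⟩ with hb
  have hba : algebraMap (𝓞 K) K b = a := rfl
  -- The trinomial relation itself exhibits the inverse of the root.
  have hunit : b * (b * ((b ^ 2) ^ (N - 1) + 2)) = 1 := by
    apply RingOfIntegers.coe_injective
    simp only [map_mul, map_add, map_pow, map_ofNat, map_one]
    rw [hba, ← ha]
    obtain ⟨M, rfl⟩ : ∃ M, N = M + 1 := ⟨N - 1, by omega⟩
    rw [Nat.add_sub_cancel]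
    ring
  have hb0 : b ≠ 0 := left_ne_zero_of_mul_eq_one hunit
  have ha0 : a ≠ 0 := by simpa [← hba] using hb0
  have hlog : ∑ w : InfinitePlace K, w.mult * Real.log (w a) = 0 :=
    Units.sum_mult_mul_log (Units.mkOfMulEqOne b _ hunit)
  refine (latticeMinDist_sq_le hb0).trans ?_
  have hφ : ∀ φ : K →+* ℂ, (φ a ^ 2) ^ N + 2 * φ a ^ 2 = 1 := by
    intro φ
    have := congrArg φ ha
    simpa only [map_add, map_mul, map_pow, map_ofNat, map_one] using this
  -- From 2y = 1 - y^N and y^N ≤ 2^(-N) ≤ 1/N.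
  have hlogy : -Real.log y ≤ Real.log 2 + 2 / N := by
    have h1 : y ^ N ≤ 1 / N := by
      have h2 : (N : ℝ) ≤ 2 ^ N := by exact_mod_cast Nat.lt_two_pow_self.le
      calc y ^ N ≤ (1 / 2) ^ N := by gcongr
        _ = 1 / 2 ^ N := by rw [div_pow, one_pow]
        _ ≤ 1 / N := by gcongr
    have h3 : Real.log y = Real.log (2 * y) - Real.log 2 := by
      rw [Real.log_mul (by norm_num) hy0.ne']
      ring
    have h4 := Real.one_sub_inv_le_log_of_pos (x := 2 * y) (by linarith)
    have h5 : (2 * y)⁻¹ ≤ 1 + 2 / N := by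
      rw [inv_le_iff_one_le_mul₀' (by linarith)]
      have h6 : 1 - 1 / (N : ℝ) ≤ 2 * y := by linarith
      have h7 : (1 : ℝ) / N ≤ 1 / 2 := by
        rw [div_le_div_iff₀ hNpos (by norm_num)]
        linarith
      have h8 : (0 : ℝ) < 1 / N := by positivity
      have h9 : (2 : ℝ) / N = 2 * (1 / N) := by ring
      rw [h9]
      nlinarith
    linarith
  -- The logarithmic terms cancel on summation by `hlog`, leaving a constant for each type of place.
  have hw : ∀ w : InfinitePlace K, w a ^ 2 ≤ w.mult * Real.log (w a) +
      ((2 - w.mult) * (1 / 2 + Real.log 2 / 2 + 1 / N) +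
        (w.mult - 1) * (1 + 4 / (N : ℝ) ^ 2)) := by
    intro w
    have hpos : 0 < w a := pos_iff.mpr ha0
    rcases mult_eq_one_or_two w with ⟨hwr, h⟩ | ⟨hwc, h⟩
    · set r : ℝ := embedding_of_isReal hwr a
      have hr : w.embedding a = r := (embedding_of_isReal_apply hwr a).symm
      have hwa : w a ^ 2 = r ^ 2 := by
        rw [← norm_embedding_eq, hr, Complex.norm_real, Real.norm_eq_abs, sq_abs]
      have h1 : (r ^ 2) ^ N + 2 * r ^ 2 = 1 := by
        have := hφ w.embedding
        rw [hr] at this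
        exact_mod_cast this
      have h2 : r ^ 2 = y := by
        have := eq_small_root hy0 hy1 hy (z := ((r ^ 2 : ℝ) : ℂ)) (by
          rw [Complex.norm_real, Real.norm_of_nonneg (sq_nonneg r)]
          have : 0 ≤ (r ^ 2) ^ N := by positivity
          linarith) (by exact_mod_cast h1)
        exact_mod_cast this
      have h3 : Real.log y = 2 * Real.log (w a) := by
        rw [← h2, ← hwa, Real.log_pow, Nat.cast_ofNat]
      have h4 : (2 : ℝ) / N = 2 * (1 / N) := by ring
      rw [h, hwa, h2]
      linarith
    · set u : ℂ := w.embedding a ^ 2 with hu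
      have hun : ‖u‖ = w a ^ 2 := by rw [hu, norm_pow, norm_embedding_eq]
      have hu1 : 1 < ‖u‖ := by
        by_contra! hle
        have h1 := eq_small_root hy0 hy1 hy hle (hφ w.embedding)
        rw [← hxy] at h1
        push_cast at h1
        refine (isComplex_iff.mp hwc) (hreal _ ?_)
        rcases sq_eq_sq_iff_eq_or_eq_neg.mp h1 with h2 | h2
        · exact ⟨x, h2⟩
        · exact ⟨-x, by rw [h2]; push_cast; rfl⟩
      have huN : ‖u‖ ^ N ≤ 1 + 2 * ‖u‖ := by
        have h1 : u ^ N = 1 - 2 * u := by linear_combination hφ w.embedding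
        rw [← norm_pow, h1]
        refine (norm_sub_le _ _).trans (le_of_eq ?_)
        simp
      -- This uses N ≥ 3: v^3 > 1 + 2v for v ≥ 2.
      have hu2 : ‖u‖ < 2 := by
        by_contra! hle
        have h1 : ‖u‖ ^ 3 ≤ ‖u‖ ^ N := pow_le_pow_right₀ hu1.le hN
        nlinarith [mul_self_nonneg (‖u‖ - 2), pow_succ ‖u‖ 2]
      set l := Real.log ‖u‖ with hl
      have hl0 : 0 < l := Real.log_pos hu1
      -- Here |u|^N ≤ 1 + 2|u| < 5 < e^2.
      have hl1 : N * l ≤ 2 := by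
        rw [hl, ← Real.log_pow, Real.log_le_iff_le_exp (by positivity)]
        have h1 := Real.exp_one_gt_d9
        have h2 : Real.exp 2 = Real.exp 1 * Real.exp 1 := by rw [← Real.exp_add]; norm_num
        nlinarith
      have hl2 : l ≤ 2 / N := by rw [le_div_iff₀' hNpos]; exact hl1
      have hl3 : l ≤ 1 := by nlinarith
      have hexp := (abs_le.mp (Real.abs_exp_sub_one_sub_id_le (x := l)
        (by rw [abs_of_pos hl0]; exact hl3))).2
      rw [hl, Real.exp_log (by linarith), ← hl] at hexp
      have h5 : l = 2 * Real.log (w a) := by rw [hl, hun, Real.log_pow, Nat.cast_ofNat]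
      have h6 : l ^ 2 ≤ 4 / (N : ℝ) ^ 2 := by
        calc l ^ 2 ≤ (2 / N) ^ 2 := by gcongr
          _ = 4 / (N : ℝ) ^ 2 := by rw [div_pow]; norm_num
      rw [h, ← hun]
      linarith
  refine (Finset.sum_le_sum fun w _ => hw w).trans (le_of_eq ?_)
  rw [Finset.sum_add_distrib, hlog, zero_add, sum_mult_affine]

theorem exists_numberField_latticeMinDist_le {N m : ℕ} (hN : 3 ≤ N) (hm : m ≠ 0) :
    ∃ (K : Type) (_ : Field K) (_ : NumberField K),
      Module.finrank ℚ K = N * (2 * m) ∧ HasSignature K (2 * m) ((N - 1) * m) ∧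
        latticeMinDist K ^ 2 ≤ (2 * m : ℝ) * (1 / 2 + Real.log 2 / 2 + 1 / N) +
          ((N - 1) * m : ℝ) * (1 + 4 / (N : ℝ) ^ 2) := by
  obtain ⟨F, _, _, a, hdeg, ha, hcard, hF⟩ := exists_field_root_evenTrinomial (N := N) (by omega)
  obtain ⟨K, _, _, _, hKdeg, hK⟩ := exists_extension_isReal F hm
  have hrank : Module.finrank ℚ K = N * (2 * m) := by
    rw [← Module.finrank_mul_finrank ℚ F K, hdeg, hKdeg]
    ring
  have hr : nrRealPlaces K = 2 * m := by
    classical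
    rw [← card_real_embeddings, ← Nat.card_eq_fintype_card, card_isReal_eq_finrank_mul F K hK,
      hcard, hKdeg]
  have hc : nrComplexPlaces K = (N - 1) * m := by
    have h := card_add_two_mul_card_eq_rank K
    obtain ⟨M, rfl⟩ : ∃ M, N = M + 1 := ⟨N - 1, by omega⟩
    rw [hr, hrank] at h
    rw [Nat.add_sub_cancel]
    linarith
  refine ⟨K, _, _, hrank, ⟨hr, hc⟩, ?_⟩
  -- An embedding of K taking `a` to a real number is real on F by `hF`, hence real on K by `hK`.
  have h := latticeMinDist_sq_le_of_root hN (a := algebraMap F K a)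
    (by simpa only [map_add, map_mul, map_pow, map_ofNat, map_one] using
      congrArg (algebraMap F K) ha)
    (fun φ hφ => hK φ (hF _ hφ))
  rw [hr, hc] at h
  push_cast [Nat.cast_sub (by omega : 1 ≤ N)] at h
  exact h

end

/-! ### The stated bounds -/

theorem one_add_mul_log_two_le (u : ℝ) : 1 + u * Real.log 2 ≤ (2 : ℝ) ^ u := by
  rw [Real.rpow_def_of_pos (by norm_num), mul_comm (Real.log 2), add_comm]
  exact Real.add_one_le_exp _

theorem theorem3p8 :
    (∃ C : ℝ, ∀ s k n : ℕ, 2 ≤ s → Even s → 1 ≤ k → n = (2 * k + 1) * s →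
      ∃ (K : Type) (_ : Field K) (_ : NumberField K),
        Module.finrank ℚ K = n ∧
        HasSignature K s ((n - s) / 2) ∧
        latticeMinDist K ^ 2 ≤
          (n : ℝ) / 2 + (s : ℝ) * Real.log 2 / 2 +
            C * ((s : ℝ) ^ (5 / 4 : ℝ) * (n : ℝ) ^ (-(1 / 4) : ℝ)) ∧
        normalisedMinDistSq K ≤
          1 - (1 - Real.log 2) / (2 * ((k : ℝ) + 1)) + C * (k : ℝ) ^ (-(5 / 4) : ℝ) ∧
        normalisedMinDistSq K ≤
          (2 : ℝ) ^ ((s : ℝ) / n) / (1 + (s : ℝ) / n) + C * (k : ℝ) ^ (-(5 / 4) : ℝ)) ∧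
    (∀ (L : Type*) [Field L] [NumberField L] (n s t : ℕ),
      Module.finrank ℚ L = n → HasSignature L s t →
        (2 : ℝ) ^ ((s : ℝ) / n) / (1 + (s : ℝ) / n) ≤ normalisedMinDistSq L) := by
  -- With N = 2k + 1, the constant 3 collects s/N from the real places and at most 2s/N from the
  -- complex ones.
  refine ⟨⟨3, ?_⟩, fun L _ _ n s t hn hst => le_normalisedMinDistSq hn hst⟩
  rintro s k n hs ⟨m, rfl⟩ hk rfl
  obtain ⟨K, _, _, hrank, hsig, hd⟩ :=
    exists_numberField_latticeMinDist_le (N := 2 * k + 1) (m := m) (by omega) (by omega)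
  have hk1 : (1 : ℝ) ≤ k := by exact_mod_cast hk
  have hk0 : (0 : ℝ) < k := by linarith
  have hm0 : (0 : ℝ) < m := by
    have : 0 < m := by omega
    exact_mod_cast this
  have ht : ((2 * k + 1) * (m + m) - (m + m)) / 2 = (2 * k + 1 - 1) * m := by
    have : (2 * k + 1) * (m + m) - (m + m) = 2 * (2 * k * m) := by
      rw [add_mul, one_mul, Nat.add_sub_cancel]
      ring
    rw [this, Nat.mul_div_cancel_left _ two_pos, Nat.add_sub_cancel]
  -- the error term is `O(s / N)`
  have hd' : latticeMinDist K ^ 2 ≤ (2 * m : ℝ) *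
      ((2 * k + 1) / 2 + Real.log 2 / 2 + 3 / (2 * k + 1)) := by
    refine hd.trans ?_
    push_cast
    have h1 : (2 * k + 1 - 1 : ℝ) * m * (4 / (2 * k + 1) ^ 2) ≤ (2 * m) * (2 / (2 * k + 1)) := by
      rw [mul_div_assoc', mul_div_assoc', div_le_div_iff₀ (by positivity) (by positivity)]
      nlinarith [mul_pos hm0 (by positivity : (0 : ℝ) < 2 * k + 1)]
    have h2 : (3 : ℝ) / (2 * k + 1) = 2 / (2 * k + 1) + 1 / (2 * k + 1) := by ring
    rw [h2]
    linarith
  have hNm : normalisedMinDistSq K ≤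
      1 - (1 - Real.log 2) / (2 * ((k : ℝ) + 1)) + 3 * (k : ℝ) ^ (-(5 / 4) : ℝ) := by
    have h1 : (1 : ℝ) / ((2 * k + 1) * (k + 1)) ≤ (k : ℝ) ^ (-(5 / 4) : ℝ) := by
      calc (1 : ℝ) / ((2 * k + 1) * (k + 1)) ≤ 1 / (k * k) := by
            gcongr <;> linarith
        _ = (k : ℝ) ^ (-2 : ℝ) := by
            rw [Real.rpow_neg hk0.le, Real.rpow_two, one_div, pow_two]
        _ ≤ (k : ℝ) ^ (-(5 / 4) : ℝ) := Real.rpow_le_rpow_of_exponent_le hk1 (by norm_num)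
    rw [normalisedMinDistSq, hsig.1, hsig.2, Nat.add_sub_cancel]
    push_cast
    have h2 : (2 * m + 2 * k * m : ℝ) = 2 * m * (k + 1) := by ring
    rw [h2, div_le_iff₀ (by positivity)]
    refine hd'.trans ?_
    have h3 : (2 * m : ℝ) * ((2 * k + 1) / 2 + Real.log 2 / 2 + 3 / (2 * k + 1)) =
        (1 - (1 - Real.log 2) / (2 * ((k : ℝ) + 1)) + 3 * (1 / ((2 * k + 1) * (k + 1)))) *
          (2 * m * (k + 1)) := by
      field_simp
      ring
    rw [h3]
    gcongr
  refine ⟨K, _, _, by rw [hrank]; ring, ?_, ?_, hNm, hNm.trans ?_⟩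
  · rw [ht, ← two_mul]
    exact hsig
  · refine hd'.trans ?_
    push_cast
    have hN1 : (1 : ℝ) ≤ 2 * k + 1 := by linarith
    have hs0 : (0 : ℝ) < m + m := by linarith
    -- Since n = Ns, the required error is s N^(-1/4), which dominates s/N.
    have h1 : (m + m : ℝ) ^ (5 / 4 : ℝ) * ((2 * k + 1) * (m + m) : ℝ) ^ (-(1 / 4) : ℝ) =
        (m + m) * (2 * k + 1 : ℝ) ^ (-(1 / 4) : ℝ) := by
      rw [Real.mul_rpow (by linarith) hs0.le, mul_left_comm, ← Real.rpow_add hs0]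
      norm_num
      ring
    have h2 : (1 : ℝ) / (2 * k + 1) ≤ (2 * k + 1 : ℝ) ^ (-(1 / 4) : ℝ) := by
      rw [one_div, ← Real.rpow_neg_one]
      exact Real.rpow_le_rpow_of_exponent_le hN1 (by norm_num)
    have h3 : (m + m : ℝ) * (1 / (2 * k + 1)) ≤ (m + m) * (2 * k + 1 : ℝ) ^ (-(1 / 4) : ℝ) := by
      gcongr
    have h4 : (3 : ℝ) / (2 * k + 1) = 3 * (1 / (2 * k + 1)) := by ring
    rw [h1, h4]
    linarith
  · gcongr
    have hu : (((m + m : ℕ) : ℝ) / (((2 * k + 1) * (m + m) : ℕ) : ℝ)) = 1 / (2 * k + 1) := by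
      push_cast
      field_simp
    rw [hu]
    -- At u = 1/(2k + 1), the quotient (1 + u log 2)/(1 + u) equals 1 - (1 - log 2)/(2(k + 1))
    -- exactly.
    refine le_trans (le_of_eq ?_)
      (div_le_div_of_nonneg_right (one_add_mul_log_two_le _) (by positivity))
    field_simp
    ring
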